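/- Setting. Let $\Omega\subset\mathbb R^2$ be open and bounded, $\mu,\nu$ non-negative Radon measures on $\mathbb R^2$, and $\psi:\mathbb R^2\to\mathbb R$ convex, with subdifferential $$\partial\psi(x)=\{z\in\mathbb R^2:\ \psi(y)\ge\psi(x)+z\cdot(y-x)\ \ \forall y\in\mathbb R^2\},\qquad \partial\psi(A)=\bigcup_{x\in A}\partial\psi(x).$$ Assume $\mu(A)\le\nu(\partial\psi(A))$ for all Borel sets $A\subset\Omega$, and that there are constants $h_1,h_2\ge0$ and $\lambda_1,\lambda_2>0$ such that $$\mu(R)\ge\frac{|R|}{\lambda_1},\qquad \nu(R'\cap\partial\psi(\Omega))\le\lambda_2|R'|$$ for all (closed, non-degenerate, arbitrarily oriented) rectangles $R\subset\Omega$ with both side lengths at least $h_1$ and $R'\subset\mathbb R^2$ with both side lengths at least $h_2$. For $\delta>0$ let $\Omega^\delta=\{x\in\Omega:\ \mathrm{dist}(x,\partial\Omega)>\delta\}$, let $U_\delta(x,y)=\bigcup_{z\in[x,y]}B_\delta(z)$, and let $\psi^*(z)=\sup_{x\in\Omega}(x\cdot z-\psi(x))$ for $z\in\mathbb R^2$.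 Let $K$ be any constant with $K\ge\mathrm{diam}\,\partial\psi(U_\delta(x,y))$ for all $x,y\in\Omega^\delta$ with $U_\delta(x,y)\subset\Omega$ (for instance $K=\mathrm{diam}\,\partial\psi(\Omega)$). Corollary ($C^1$ regularity of $\psi^*$). (i) There are functions $\rho,\rho_1,\rho_2$, monotone increasing on $[0,\infty)$, zero at $0$ and with limit $0$ at $0^+$, depending only on $\delta$, $\lambda_1\lambda_2$, $D=\mathrm{diam}\,\Omega$ and $K$, such that for all $z,z'\in\partial\psi(\Omega^\delta)$ $$|x-x'|\le\max\big(\rho(|z-z'|),\rho_1(h_1),\rho_2(h_2)\big)\qquad\forall x\in\partial\psi^*(z),\ x'\in\partial\psi^*(z').$$ (ii) If $h_1=h_2=0$, then $\psi^*$ is $C^1$ on $\partial\psi(\Omega^\delta)$ (that is, $C^1$ in a neighbourhood of each of its points), and there is a constant $C>0$ depending only on $\delta$ and $D$ such that, for every Lipschitz constant $L_\infty$ of $\psi$ on $\Omega$ and all $z\ne z'$ in $\partial\psi(\Omega^\delta)$, $$|\nabla\psi^*(z)-\nabla\psi^*(z')|\le C\,\frac{\sqrt{\lambda_1\lambda_2}\,L_\infty}{\Big(\log\big(1+\frac{1}{C\sqrt{\lambda_1\lambda_2}\,|z-z'|}\big)\Big)^{1/8}}.$$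 -/

import Mathlib

open MeasureTheory Set Filter Topology

noncomputable section

/-- The Euclidean plane. -/
abbrev Plane : Type := EuclideanSpace ℝ (Fin 2)

/-- The subdifferential of `f` at `x`: all `z` with `f y ≥ f x + z · (y - x)` for every `y`. -/
def subdiff (f : Plane → ℝ) (x : Plane) : Set Plane :=
  {z | ∀ y : Plane, f x + inner ℝ z (y - x) ≤ f y}

/-- The image `⋃ x ∈ A, subdiff f x` of a set under the subdifferential. -/
def subdiffImage (f : Plane → ℝ) (A : Set Plane) : Set Plane :=
  ⋃ x ∈ A, subdiff f x

/-- The Legendre dual of `ψ` relative to `Ω`: the supremum of `x · z - ψ x` over `x ∈ Ω`.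
For a finite convex `ψ` and a bounded nonempty `Ω` it is finite at every `z`. -/
def legendre (Ω : Set Plane) (ψ : Plane → ℝ) (z : Plane) : ℝ :=
  ⨆ x : Ω, (inner ℝ (x : Plane) z - ψ x)

/-- The points of `Ω` at distance more than `δ` from the boundary of `Ω`. -/
def innerSet (Ω : Set Plane) (δ : ℝ) : Set Plane :=
  {x | x ∈ Ω ∧ δ < Metric.infDist x (frontier Ω)}

/-- The `δ`-neighbourhood of the segment `[x, y]`. -/
def segmentNhd (x y : Plane) (δ : ℝ) : Set Plane :=
  ⋃ z ∈ segment ℝ x y, Metric.ball z δ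

/-- The closed rectangle with corner `c`, sides along the orthonormal basis `e` (an arbitrary
orientation) and side lengths `a` and `b`. -/
def rectangle (c : Plane) (e : OrthonormalBasis (Fin 2) ℝ Plane) (a b : ℝ) : Set Plane :=
  {x | inner ℝ (e 0) (x - c) ∈ Icc 0 a ∧ inner ℝ (e 1) (x - c) ∈ Icc 0 b}

/-- The standing hypotheses on the domain `Ω`, the measures `μ`, `ν` and the convex function `ψ`,
with density constants `lam₁`, `lam₂` and discrete scales `h₁`, `h₂` (possibly zero). -/
structure Admissible (Ω : Set Plane) (μ ν : Measure Plane) (ψ : Plane → ℝ)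
    (lam₁ lam₂ h₁ h₂ : ℝ) : Prop where
  isOpen : IsOpen Ω
  isBounded : Bornology.IsBounded Ω
  /-- `μ` and `ν` are Radon measures: locally finite Borel measures on the plane. -/
  locallyFinite_left : IsLocallyFiniteMeasure μ
  locallyFinite_right : IsLocallyFiniteMeasure ν
  convex : ConvexOn ℝ univ ψ
  lam₁_pos : 0 < lam₁
  lam₂_pos : 0 < lam₂
  h₁_nonneg : 0 ≤ h₁
  h₂_nonneg : 0 ≤ h₂
  /-- The one-sided transport inequality `μ(A) ≤ ν(∂ψ(A))`. -/
  transport : ∀ A : Set Plane, MeasurableSet A → A ⊆ Ω → μ A ≤ ν (subdiffImage ψ A)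
  /-- `μ(R) ≥ |R| / lam₁` for rectangles in `Ω` with sides at least `h₁`. -/
  lower : ∀ (c : Plane) (e : OrthonormalBasis (Fin 2) ℝ Plane) (a b : ℝ),
    0 < a → 0 < b → h₁ ≤ a → h₁ ≤ b → rectangle c e a b ⊆ Ω →
      volume (rectangle c e a b) / ENNReal.ofReal lam₁ ≤ μ (rectangle c e a b)
  /-- `ν(R' ∩ ∂ψ(Ω)) ≤ lam₂ |R'|` for rectangles with sides at least `h₂`. -/
  upper : ∀ (c : Plane) (e : OrthonormalBasis (Fin 2) ℝ Plane) (a b : ℝ),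
    0 < a → 0 < b → h₂ ≤ a → h₂ ≤ b →
      ν (rectangle c e a b ∩ subdiffImage ψ Ω) ≤
        ENNReal.ofReal lam₂ * volume (rectangle c e a b)

/-- A modulus: increasing on `[0, ∞)`, zero at `0`, with limit `0` at `0` from the right. -/
def IsModulus (ρ : ℝ → ℝ) : Prop :=
  MonotoneOn ρ (Ici 0) ∧ ρ 0 = 0 ∧ Tendsto ρ (𝓝[>] 0) (𝓝 0)

end

/-! Fix `z ∈ ∂ψ(x₀)` with `x₀` well inside `Ω`, and let `x'` be a subgradient of the dual at a
nearby `z'`. By duality, `ψ` minus its support plane at `x₀` is at most `s |z - z'|` on the initial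
piece of length `s` of the segment from `x₀` to `x'`. The point is that a convex function cannot be
that flat along a long segment if its subdifferential does not contract area by more than a fixed
factor.

Take coordinates with the segment on the horizontal axis and let `F` be the resulting nonnegative
convex function. At height about `r`, convexity makes the horizontal slopes of order `K r / s` over
the middle half of the segment, so the image of an `s / 2` by `r` rectangle has width of order `K r
/ s`. The area bound then forces its vertical slopes to spread by at least a multiple of `s² / (Λ
K)`, independently of `r`. Up to an error of order `K / n`, that spread is controlled by the growth
of the vertical slope from height `r` to `4 r`, summed over `n + 1` vertical grid lines
(`abs_vertical_slope_sub_le`). Vertical slopes increase along each line and stay in `[-K, K]`, so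
only boundedly many levels `r = 4 ^ k r₀` can pay this price (`level_count_le`).

The number of available levels is about `log (1 / |z - z'|)`, and the bound on it is of order `(Λ K²
/ s²)²` when `n` is about `Λ K² / s²`. This yields the moduli by contradiction and the logarithmic
rate by keeping constants. When `h₁ = h₂ = 0`, the subgradients of the dual near `z` converge to
`x₀`, which gives differentiability and continuity of the gradient. -/

/-! ### Slope estimates for convex functions of two real variables -/

/-- `(p, q)` is a subgradient at `(t, y)` of the function `F` of two real variables. -/
def IsSubgradientAt (F : ℝ → ℝ → ℝ) (t y p q : ℝ) : Prop :=
  ∀ t' y', F t y + p * (t' - t) + q * (y' - y) ≤ F t' y'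

namespace IsSubgradientAt

variable {F : ℝ → ℝ → ℝ} {t y p q y' p' q' : ℝ}

theorem vertical_mono (h : IsSubgradientAt F t y p q) (h' : IsSubgradientAt F t y' p' q')
    (hy : y < y') : q ≤ q' := by
  have h1 := h t y'
  have h2 := h' t y
  by_contra! hq
  nlinarith [mul_pos (sub_pos.2 hy) (sub_pos.2 hq)]

end IsSubgradientAt

/-- A nonnegative function with subgradients, almost vanishing on `[0, s] × {0}` and with vertical
slopes at most `K`, has horizontal slopes of order `r / s` at height `r`. -/
theorem abs_horizontal_slope_le {F : ℝ → ℝ → ℝ} {s K r : ℝ} (hs : 0 < s) (hK : 0 < K)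
    (hr : 0 < r) (hex : ∀ t y, ∃ p q, IsSubgradientAt F t y p q) (hF : ∀ t y, 0 ≤ F t y)
    (hF0 : ∀ t ∈ Icc 0 s, F t 0 ≤ K * r)
    (hq : ∀ t ∈ Icc 0 s, ∀ y ∈ Icc 0 (4 * r), ∀ p q, IsSubgradientAt F t y p q → |q| ≤ K)
    {t y p q : ℝ} (ht : t ∈ Icc (s / 4) (3 * s / 4)) (hy : y ∈ Icc 0 (4 * r))
    (h : IsSubgradientAt F t y p q) : |p| ≤ 20 * K * r / s := by
  -- `K r` on the axis plus at most `K · 4 r` from climbing. Since the distance to either end of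
  -- `[0, s]` is at least `s / 4`, the slope is at most `5 K r / (s / 4)`.
  have upper : ∀ t ∈ Icc 0 s, F t y ≤ 5 * K * r := by
    intro t ht
    obtain ⟨p, q, h⟩ := hex t y
    have h1 := h t 0
    have h2 := (abs_le.1 (hq t ht y hy p q h)).2
    have h3 := hF0 t ht
    have := mul_le_mul h2 hy.2 hy.1 hK.le
    nlinarith
  obtain ⟨ht1, ht2⟩ := ht
  have e1 := h s y
  have e2 := h 0 y
  have u1 := upper s ⟨hs.le, le_rfl⟩
  have u2 := upper 0 ⟨le_rfl, hs.le⟩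
  have l := hF t y
  have hKr : 0 < K * r := by positivity
  rw [abs_le, neg_le, le_div_iff₀ hs, le_div_iff₀ hs]
  constructor
  · by_contra! hc
    have : 0 < -p := by by_contra! h0; nlinarith
    nlinarith
  · by_contra! hc
    have : 0 < p := by by_contra! h0; nlinarith
    nlinarith

/-- The `n + 1` equally spaced points of `[s / 4, 3 s / 4]`. -/
noncomputable def gridPoint (s : ℝ) (n i : ℕ) : ℝ := s / 4 + s / 2 * (i / n)

theorem gridPoint_mem {s : ℝ} (hs : 0 < s) {n i : ℕ} (hn : 0 < n) (hi : i ≤ n) :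
    gridPoint s n i ∈ Icc (s / 4) (3 * s / 4) := by
  have h1 : (0 : ℝ) ≤ (i : ℝ) / n := by positivity
  have h2 : (i : ℝ) / n ≤ 1 := by
    rw [div_le_one (by exact_mod_cast hn)]; exact_mod_cast hi
  constructor <;> unfold gridPoint <;> nlinarith

theorem gridPoint_succ (s : ℝ) (n i : ℕ) :
    gridPoint s n (i + 1) - gridPoint s n i = s / (2 * n) := by
  unfold gridPoint; push_cast; ring

theorem exists_gridPoint_near {s : ℝ} (hs : 0 < s) {n : ℕ} (hn : 0 < n) {t : ℝ}
    (ht : t ∈ Icc (s / 4) (3 * s / 4)) :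
    ∃ i ≤ n, |t - gridPoint s n i| ≤ s / (2 * n) := by
  have hn' : (0 : ℝ) < n := by exact_mod_cast hn
  set u := (t - s / 4) * (2 * n) / s with hu
  have hu0 : 0 ≤ u := by
    have := ht.1; have : 0 ≤ t - s / 4 := by linarith
    positivity
  have hun : u ≤ n := by
    rw [hu, div_le_iff₀ hs]; nlinarith [ht.2]
  refine ⟨⌊u⌋₊, Nat.floor_le_of_le hun, ?_⟩
  have h1 := Nat.floor_le hu0
  have h2 := Nat.lt_floor_add_one u
  have : t - gridPoint s n ⌊u⌋₊ = (u - ⌊u⌋₊) * (s / (2 * n)) := by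
    unfold gridPoint; rw [hu]; field_simp; ring
  rw [this, abs_of_nonneg (mul_nonneg (by linarith) (by positivity))]
  have : 0 ≤ s / (2 * n) := by positivity
  nlinarith

/-- At height between `2 r` and `3 r` the vertical slopes differ little from each other when the
vertical slopes on the grid lines grow little between the heights `r` and `4 r`. -/
theorem abs_vertical_slope_sub_le {F : ℝ → ℝ → ℝ} {s K r : ℝ} (hs : 0 < s) (hK : 0 < K)
    (hr : 0 < r) (hex : ∀ t y, ∃ p q, IsSubgradientAt F t y p q) (hF : ∀ t y, 0 ≤ F t y)
    (hF0 : ∀ t ∈ Icc 0 s, F t 0 ≤ K * r)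
    (hq : ∀ t ∈ Icc 0 s, ∀ y ∈ Icc 0 (4 * r), ∀ p q, IsSubgradientAt F t y p q → |q| ≤ K)
    {n : ℕ} (hn : 0 < n) {c a d b : ℕ → ℝ}
    (ha : ∀ i, IsSubgradientAt F (gridPoint s n i) r (c i) (a i))
    (hb : ∀ i, IsSubgradientAt F (gridPoint s n i) (4 * r) (d i) (b i))
    {t y p q : ℝ} (ht : t ∈ Icc (s / 4) (3 * s / 4)) (hy : y ∈ Icc (2 * r) (3 * r))
    (h : IsSubgradientAt F t y p q) :
    |q - a 0| ≤ 27 * K / n + 3 * ∑ i ∈ Finset.range (n + 1), (b i - a i) := by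
  have hn' : (0 : ℝ) < n := by exact_mod_cast hn
  have slope := @abs_horizontal_slope_le F s K r hs hK hr hex hF hF0 hq
  have hab : ∀ i, 0 ≤ b i - a i := fun i =>
    sub_nonneg.2 ((ha i).vertical_mono (hb i) (by linarith))
  set S := ∑ i ∈ Finset.range (n + 1), (b i - a i) with hS
  have hDS : ∀ i ≤ n, b i - a i ≤ S := fun i hi =>
    Finset.single_le_sum (f := fun i => b i - a i) (fun j _ => hab j)
      (Finset.mem_range.2 (by omega))
  -- neighbouring grid lines
  have step : ∀ i, |a (i + 1) - a i| ≤
      (c (i + 1) - c i) * (s / (6 * n * r)) + (b i - a i) + (b (i + 1) - a (i + 1)) := by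
    intro i
    have hw := gridPoint_succ s n i
    set w := s / (2 * n) with hwdef
    have hw0 : 0 < w := by positivity
    have hw6 : s / (6 * n * r) = w / (3 * r) := by rw [hwdef]; field_simp; ring
    rw [hw6]
    set x := gridPoint s n i
    have hx : gridPoint s n (i + 1) = x + w := by linarith
    have ha1 := ha (i + 1)
    have hb1 := hb (i + 1)
    rw [hx] at ha1 hb1
    have e1 := ha i (x + w) (4 * r)
    have e2 := ha i (x + w) r
    have e3 := ha1 x r
    have e4 := ha1 x (4 * r)
    have e5 := hb1 (x + w) r
    have e6 := hb i x r
    -- Cyclic monotonicity around the triangle `(x, r)`, `(x + w, 4 r)`, `(x + w, r)`; the next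
    -- inequality uses the triangle `(x + w, r)`, `(x, 4 r)`, `(x, r)`. Both leave the same
    -- difference of horizontal slopes.
    have f1 : a i - b (i + 1) ≤ (c (i + 1) - c i) * (w / (3 * r)) := by
      rw [mul_div_assoc', le_div_iff₀ (by positivity)]; linarith
    have f2 : a (i + 1) - b i ≤ (c (i + 1) - c i) * (w / (3 * r)) := by
      rw [mul_div_assoc', le_div_iff₀ (by positivity)]; linarith
    have := hab i
    have := hab (i + 1)
    rw [abs_le]; constructor <;> linarith
  -- The horizontal slope differences telescope, so crossing all `n` gaps costs one total variation,
  -- at most `40 K r / s`, times the mesh factor: an error of order `K / n` rather than `K`. The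
  -- subtracted last term records that the end line has been counted only once so far.
  have tele : ∀ m, |a m - a 0| ≤ (c m - c 0) * (s / (6 * n * r)) +
      2 * ∑ i ∈ Finset.range (m + 1), (b i - a i) - (b m - a m) := by
    intro m
    induction m with
    | zero => simp; linarith [hab 0]
    | succ m ih =>
      have h1 := step m
      have h2 := abs_sub_le (a (m + 1)) (a m) (a 0)
      rw [Finset.sum_range_succ _ (m + 1)]
      linarith
  have grid : ∀ i ≤ n, |a i - a 0| ≤ 7 * K / n + 2 * S := by
    intro i hi
    have h1 := tele i
    have h2 : ∑ j ∈ Finset.range (i + 1), (b j - a j) ≤ S :=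
      Finset.sum_le_sum_of_subset_of_nonneg (Finset.range_subset_range.2 (by omega))
        (fun j _ _ => hab j)
    have s1 := abs_le.1 (slope (gridPoint_mem hs hn hi) ⟨hr.le, by linarith⟩ (ha i))
    have s2 := abs_le.1 (slope (gridPoint_mem hs hn (Nat.zero_le n)) ⟨hr.le, by linarith⟩ (ha 0))
    have h3 : (c i - c 0) * (s / (6 * n * r)) ≤ (40 * K * r / s) * (s / (6 * n * r)) := by
      apply mul_le_mul_of_nonneg_right _ (by positivity)
      have : 40 * K * r / s = 20 * K * r / s + 20 * K * r / s := by ring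
      linarith
    have h4 : (40 * K * r / s) * (s / (6 * n * r)) ≤ 7 * K / n := by
      have : (40 * K * r / s) * (s / (6 * n * r)) = (20 / 3) * (K / n) := by field_simp; ring
      rw [this, mul_div_assoc]
      have : 0 < K / n := by positivity
      linarith
    linarith [hab i]
  obtain ⟨i, hi, hti⟩ := exists_gridPoint_near hs hn ht
  have hxi := gridPoint_mem hs hn hi
  set x := gridPoint s n i with hx
  -- horizontal Lipschitz bound
  have lip : ∀ z ∈ Icc 0 (4 * r), ∀ t₁ ∈ Icc (s / 4) (3 * s / 4), ∀ t₂ : ℝ,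
      |t₁ - t₂| ≤ s / (2 * n) → F t₁ z - F t₂ z ≤ 10 * K * r / n := by
    intro z hz t₁ ht₁ t₂ h12
    obtain ⟨p, q, hpq⟩ := hex t₁ z
    have h1 := hpq t₂ z
    have h2 := slope ht₁ hz hpq
    have h3 : p * (t₁ - t₂) ≤ 20 * K * r / s * (s / (2 * n)) := by
      refine (le_abs_self _).trans ?_
      rw [abs_mul]
      exact mul_le_mul h2 h12 (abs_nonneg _) (by positivity)
    have h4 : 20 * K * r / s * (s / (2 * n)) = 10 * K * r / n := by field_simp; ring
    linarith
  have hti' : |x - t| ≤ s / (2 * n) := by rwa [abs_sub_comm]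
  obtain ⟨hy1, hy2⟩ := hy
  have hy0 : y ∈ Icc 0 (4 * r) := ⟨by linarith, by linarith⟩
  have key : 20 * K * r / n = (20 * K / n) * r := by ring
  have key2 : 20 * K * r / n = 10 * K * r / n + 10 * K * r / n := by ring
  have hE : 0 < 20 * K / n := by positivity
  -- Compare with the nearest grid line at heights `y` and `4 r`. Changing lines twice costs `20 K r
  -- / n`, and the vertical distance is at least `r` because `y ≤ 3 r`; the lower bound uses `y ≥ 2
  -- r` in the same way.
  have up : q ≤ b i + 20 * K / n := by
    have e1 := h t (4 * r)
    have e2 := hb i x y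
    have e3 := lip (4 * r) ⟨by linarith, le_rfl⟩ t ht x hti
    have e4 := lip y hy0 x hxi t hti'
    by_contra! hc
    nlinarith
  have lo : a i - 20 * K / n ≤ q := by
    have e1 := h t r
    have e2 := ha i x y
    have e3 := lip r ⟨hr.le, by linarith⟩ t ht x hti
    have e4 := lip y hy0 x hxi t hti'
    by_contra! hc
    nlinarith
  have h1 := abs_le.1 (grid i hi)
  have h2 := hDS i hi
  have h3 : 27 * K / n = 7 * K / n + 20 * K / n := by ring
  have h4 := hab i
  rw [abs_le]
  constructor <;> linarith

/-! ### Counting the levels -/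

/-- The number `M` of dyadic levels between the height `r₀` and the size `d` of the domain is
bounded when subgradient images of rectangles have area at least `1 / Λ` times that of the
rectangle, at scales above `h₁` and `h₂`. -/
theorem level_count_le {F : ℝ → ℝ → ℝ} {s K r₀ d Λ h₁ h₂ : ℝ} (hs : 0 < s) (hK : 0 < K)
    (hr₀ : 0 < r₀) (hΛ : 0 < Λ) (hex : ∀ t y, ∃ p q, IsSubgradientAt F t y p q)
    (hF : ∀ t y, 0 ≤ F t y) (hF0 : ∀ t ∈ Icc 0 s, F t 0 ≤ K * r₀)
    (hq : ∀ t ∈ Icc 0 s, ∀ y ∈ Icc 0 d, ∀ p q, IsSubgradientAt F t y p q → |q| ≤ K)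
    (harea : ∀ c₁ d₁ c₂ d₂ p₀ q₀ A B : ℝ, 0 ≤ c₁ → d₁ ≤ s → 0 ≤ c₂ → d₂ ≤ d → c₁ < d₁ → c₂ < d₂ →
      h₁ ≤ d₁ - c₁ → h₁ ≤ d₂ - c₂ → 0 < A → 0 < B → h₂ ≤ A → h₂ ≤ B →
      (∀ t ∈ Icc c₁ d₁, ∀ y ∈ Icc c₂ d₂, ∀ p q, IsSubgradientAt F t y p q →
        p ∈ Icc p₀ (p₀ + A) ∧ q ∈ Icc q₀ (q₀ + B)) →
      (d₁ - c₁) * (d₂ - c₂) ≤ Λ * (A * B))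
    {n M : ℕ} (hn : 8640 * Λ * K ^ 2 ≤ n * s ^ 2) (hM : 4 ^ M * r₀ ≤ d)
    (h₁s : h₁ ≤ s / 2) (h₁r : h₁ ≤ r₀) (h₂r : h₂ ≤ 40 * K * r₀ / s) (h₂n : h₂ ≤ 54 * K / n) :
    M * s ^ 2 ≤ 1920 * Λ * K ^ 2 * (n + 1) := by
  have hn0 : 0 < n := by
    rcases Nat.eq_zero_or_pos n with rfl | h
    · have : 0 < 8640 * Λ * K ^ 2 := by positivity
      simp at hn; linarith
    · exact h
  have hn' : (0 : ℝ) < n := by exact_mod_cast hn0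
  choose P Q hPQ using hex
  set g : ℕ → ℕ → ℝ := fun k i => Q (gridPoint s n i) (4 ^ k * r₀) with hg
  have level : ∀ k < M, s ^ 2 ≤
      960 * Λ * K * ∑ i ∈ Finset.range (n + 1), (g (k + 1) i - g k i) := by
    intro k hk
    set r := 4 ^ k * r₀ with hr
    have hr0 : 0 < r := by positivity
    have hrr : r₀ ≤ r := le_mul_of_one_le_left hr₀.le (one_le_pow₀ (by norm_num))
    have h4r : 4 * r = 4 ^ (k + 1) * r₀ := by rw [hr]; ring
    have h4d : 4 * r ≤ d := by
      rw [h4r]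
      refine le_trans ?_ hM
      exact mul_le_mul_of_nonneg_right (pow_le_pow_right₀ (by norm_num) hk) hr₀.le
    have hF0' : ∀ t ∈ Icc 0 s, F t 0 ≤ K * r := fun t ht => (hF0 t ht).trans (by gcongr)
    have hq' : ∀ t ∈ Icc 0 s, ∀ y ∈ Icc 0 (4 * r), ∀ p q, IsSubgradientAt F t y p q → |q| ≤ K :=
      fun t ht y hy => hq t ht y ⟨hy.1, hy.2.trans h4d⟩
    have hex : ∀ t y, ∃ p q, IsSubgradientAt F t y p q := fun t y => ⟨_, _, hPQ t y⟩
    have ha : ∀ i, IsSubgradientAt F (gridPoint s n i) r (P (gridPoint s n i) r) (g k i) :=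
      fun i => hPQ _ _
    have hb : ∀ i, IsSubgradientAt F (gridPoint s n i) (4 * r) (P (gridPoint s n i) (4 * r))
        (g (k + 1) i) := fun i => by
      have := hPQ (gridPoint s n i) (4 * r)
      rw [hg]; simpa only [← h4r] using this
    set S := ∑ i ∈ Finset.range (n + 1), (g (k + 1) i - g k i) with hS
    have hS0 : 0 ≤ S := Finset.sum_nonneg fun i _ =>
      sub_nonneg.2 ((ha i).vertical_mono (hb i) (by linarith))
    have hE : 0 < K / n := by positivity
    have hB : 54 * K / n = 54 * (K / n) := by ring
    -- The image rectangle is twice as wide as the slope bounds: `2 · 20 K r / s` by `2 (27 K / n +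
    -- 3 S)`.
    have area := harea (s / 4) (3 * s / 4) (2 * r) (3 * r) (-(20 * K * r / s))
      (g k 0 - (27 * K / n + 3 * S)) (40 * K * r / s) (54 * K / n + 6 * S)
      (by positivity) (by linarith) (by positivity) (by linarith) (by linarith) (by linarith)
      (by linarith) (by linarith) (by positivity) (by positivity)
      (h₂r.trans (by gcongr)) (by linarith)
      (by
        intro t ht y hy p q h
        have h1 := abs_le.1 (abs_horizontal_slope_le hs hK hr0 hex hF hF0' hq' ht
          ⟨by linarith [hy.1], by linarith [hy.2]⟩ h)
        have h2 := abs_le.1 (abs_vertical_slope_sub_le hs hK hr0 hex hF hF0' hq' hn0 ha hb ht hy h)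
        have h3 : 40 * K * r / s = 20 * K * r / s + 20 * K * r / s := by ring
        have h4 : 54 * K / n = 27 * K / n + 27 * K / n := by ring
        rw [← hS] at h2
        exact ⟨⟨h1.1, by linarith⟩, ⟨by linarith, by linarith⟩⟩)
    have h1 : s ^ 2 ≤ 80 * Λ * K * (54 * (K / n) + 6 * S) := by
      have e1 : Λ * (40 * K * r / s * (54 * K / n + 6 * S)) =
          (80 * Λ * K * (54 * (K / n) + 6 * S)) * (r / (2 * s)) := by rw [hB]; field_simp; ring
      have e2 : (3 * s / 4 - s / 4) * (3 * r - 2 * r) = s ^ 2 * (r / (2 * s)) := by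
        field_simp; ring
      rw [e1, e2] at area
      exact le_of_mul_le_mul_right area (by positivity)
    -- As `8640 = 2 · 80 · 54`, the grid error uses up at most half of `s ^ 2`, and the other half
    -- must come from `S`.
    have h2 : 8640 * Λ * K * (K / n) ≤ s ^ 2 := by
      have : 8640 * Λ * K * (K / n) = 8640 * Λ * K ^ 2 / n := by ring
      rw [this, div_le_iff₀ hn']; linarith
    linarith
  -- On each grid line the increments telescope over the levels, between two slopes in `[-K, K]`.
  have total : ∑ k ∈ Finset.range M, ∑ i ∈ Finset.range (n + 1), (g (k + 1) i - g k i) ≤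
      (n + 1) * (2 * K) := by
    rw [Finset.sum_comm]
    have : ∀ i ∈ Finset.range (n + 1), ∑ k ∈ Finset.range M, (g (k + 1) i - g k i) ≤ 2 * K := by
      intro i hi
      rw [Finset.sum_range_sub (fun k => g k i)]
      have hx := gridPoint_mem hs hn0 (i := i) (by have := Finset.mem_range.1 hi; omega)
      have hx' : gridPoint s n i ∈ Icc 0 s := ⟨by linarith [hx.1], by linarith [hx.2]⟩
      have hr₀d : r₀ ≤ d :=
        (le_mul_of_one_le_left hr₀.le (one_le_pow₀ (by norm_num))).trans hM
      have h1 := abs_le.1 (hq _ hx' (4 ^ M * r₀) ⟨by positivity, hM⟩ _ _ (hPQ _ _))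
      have h2 := abs_le.1 (hq _ hx' (4 ^ 0 * r₀) ⟨by positivity, by simpa using hr₀d⟩ _ _
        (hPQ _ _))
      simp only [hg]
      linarith
    simpa using Finset.sum_le_card_nsmul _ _ _ this
  have sum := Finset.sum_le_sum fun k (hk : k ∈ Finset.range M) => level k (Finset.mem_range.1 hk)
  rw [← Finset.mul_sum] at sum
  simp only [Finset.sum_const, Finset.card_range, nsmul_eq_mul] at sum
  calc M * s ^ 2 ≤ _ := sum
    _ ≤ 960 * Λ * K * ((n + 1) * (2 * K)) := by gcongr
    _ = _ := by ring

/-! ### Existence and bounds of subgradients in the plane -/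

section Subdifferential

variable {ψ : Plane → ℝ}

theorem continuous_of_convexOn (hψ : ConvexOn ℝ univ ψ) : Continuous ψ :=
  continuousOn_univ.1 (hψ.continuousOn isOpen_univ)

/-- Hahn–Banach separates the graph point from the open strict epigraph; the separating functional
is not vertical, so it can be normalised to a supporting slope. -/
theorem subdiff_nonempty (hψ : ConvexOn ℝ univ ψ) (x : Plane) : (subdiff ψ x).Nonempty := by
  have hcont := continuous_of_convexOn hψ
  let s : Set (Plane × ℝ) := {p | ψ p.1 < p.2}
  have hs : Convex ℝ s := by simpa [s] using hψ.convex_strict_epigraph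
  have hso : IsOpen s := isOpen_lt (hcont.comp continuous_fst) continuous_snd
  obtain ⟨f, hf⟩ := geometric_hahn_banach_open_point (x := (x, ψ x)) hs hso (by simp [s])
  set g : StrongDual ℝ Plane := f.comp (ContinuousLinearMap.inl ℝ Plane ℝ) with hg
  set m : ℝ := f (0, 1) with hm
  have hfv : ∀ v t, f (v, t) = g v + t * m := by
    intro v t
    have : ((v, t) : Plane × ℝ) = (v, 0) + t • (0, 1) := by simp
    rw [this, map_add, map_smul]; simp [hg, hm]
  have hm0 : m < 0 := by
    have := hf (x, ψ x + 1) (by simp [s])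
    rw [hfv, hfv] at this; linarith
  refine ⟨(InnerProductSpace.toDual ℝ Plane).symm ((-m)⁻¹ • g), fun y => ?_⟩
  rw [InnerProductSpace.toDual_symm_apply]
  have key : g y + ψ y * m ≤ g x + ψ x * m := by
    refine le_of_forall_pos_le_add fun η hη => ?_
    have := hf (y, ψ y + η / (-m)) (by
      have : 0 < η / (-m) := div_pos hη (by linarith)
      simp [s, this])
    rw [hfv, hfv] at this
    have h2 : η / (-m) * m = -η := by
      have := hm0.ne
      field_simp
    nlinarith
  have hm1 : 0 < -m := by linarith
  rw [smul_apply, map_sub, smul_eq_mul]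
  have h3 : (-m)⁻¹ * (g y - g x) ≤ ψ y - ψ x := by
    rw [inv_mul_le_iff₀ hm1]; linarith
  linarith

theorem norm_le_of_mem_subdiff_of_lipschitzOnWith {Ω : Set Plane} (hΩ : IsOpen Ω) {L : NNReal}
    (hL : LipschitzOnWith L ψ Ω) {x z : Plane} (hx : x ∈ Ω) (hz : z ∈ subdiff ψ x) :
    ‖z‖ ≤ L := by
  rcases eq_or_ne z 0 with rfl | hz0
  · simp
  have hn : 0 < ‖z‖ := norm_pos_iff.2 hz0
  obtain ⟨r, hr, hball⟩ := Metric.isOpen_iff.1 hΩ x hx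
  set t : ℝ := r / (2 * ‖z‖) with ht
  have ht0 : 0 < t := by positivity
  have htn : ‖t • z‖ = r / 2 := by
    rw [norm_smul, Real.norm_of_nonneg ht0.le, ht]; field_simp
  have hy : x + t • z ∈ Ω := hball (by rw [Metric.mem_ball, dist_eq_norm]; simp [htn]; linarith)
  have h1 := hz (x + t • z)
  have h2 := hL.dist_le_mul _ hy _ hx
  rw [dist_eq_norm, dist_eq_norm, add_sub_cancel_left, norm_smul, Real.norm_of_nonneg ht0.le] at h2
  rw [add_sub_cancel_left, inner_smul_right, real_inner_self_eq_norm_sq] at h1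
  have h3 := (le_abs_self _).trans h2
  have h4 : (t * ‖z‖) * ‖z‖ ≤ (t * ‖z‖) * L := by nlinarith
  exact le_of_mul_le_mul_left h4 (by positivity)

theorem isBounded_subdiffImage (hψ : ConvexOn ℝ univ ψ) {A : Set Plane}
    (hA : Bornology.IsBounded A) : Bornology.IsBounded (subdiffImage ψ A) := by
  obtain ⟨R, hR⟩ := hA.subset_closedBall 0
  obtain ⟨B, hB⟩ := (isCompact_closedBall (0 : Plane) (R + 1)).exists_bound_of_continuousOn
    (continuous_of_convexOn hψ).continuousOn
  refine (Metric.isBounded_iff_subset_closedBall 0).2 ⟨max (2 * B) 0, ?_⟩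
  intro z hz
  simp only [subdiffImage, mem_iUnion] at hz
  obtain ⟨x, hx, hz⟩ := hz
  rw [mem_closedBall_zero_iff]
  rcases eq_or_ne z 0 with rfl | hz0
  · simp
  have hn : 0 < ‖z‖ := norm_pos_iff.2 hz0
  have hxR : ‖x‖ ≤ R := by simpa using hR hx
  have h1 := hz (x + ‖z‖⁻¹ • z)
  have hu : ‖‖z‖⁻¹ • z‖ = 1 := by
    rw [norm_smul, norm_inv, norm_norm]; field_simp
  have h2 := hB (x + ‖z‖⁻¹ • z) (by
    rw [mem_closedBall_zero_iff]; refine (norm_add_le _ _).trans ?_; rw [hu]; linarith)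
  have h3 := hB x (by rw [mem_closedBall_zero_iff]; linarith)
  rw [add_sub_cancel_left, inner_smul_right, real_inner_self_eq_norm_sq] at h1
  have h4 : ‖z‖⁻¹ * ‖z‖ ^ 2 = ‖z‖ := by field_simp
  rw [Real.norm_eq_abs] at h2 h3
  have := (abs_le.1 h2).2
  have := (abs_le.1 h3).1
  refine le_max_of_le_left ?_
  linarith

theorem mem_subdiffImage {A : Set Plane} {x z : Plane} (hx : x ∈ A) (hz : z ∈ subdiff ψ x) :
    z ∈ subdiffImage ψ A :=
  mem_biUnion hx hz

/-- The distance to the frontier is measured without reference to `Ω`, so connectedness of the ball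
is needed: a connected set that meets `Ω` and misses its frontier stays inside. -/
theorem ball_subset_of_mem_innerSet {Ω : Set Plane} (hΩ : IsOpen Ω) {δ : ℝ} {x : Plane}
    (hx : x ∈ innerSet Ω δ) : Metric.ball x δ ⊆ Ω := by
  rcases le_or_gt δ 0 with hδ | hδ
  · rw [Metric.ball_eq_empty.2 hδ]; exact empty_subset _
  refine (convex_ball x δ).isPreconnected.subset_of_closure_inter_subset hΩ
    ⟨x, Metric.mem_ball_self hδ, hx.1⟩ ?_
  rintro y ⟨hyc, hy⟩
  by_contra hyΩ
  have hyf : y ∈ frontier Ω := ⟨hyc, by rwa [hΩ.interior_eq]⟩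
  have := Metric.infDist_le_dist_of_mem (x := x) hyf
  rw [Metric.mem_ball, dist_comm] at hy
  linarith [hx.2]

theorem isOpen_innerSet {Ω : Set Plane} (hΩ : IsOpen Ω) (δ : ℝ) : IsOpen (innerSet Ω δ) :=
  hΩ.inter (isOpen_lt continuous_const (Metric.continuous_infDist_pt _))

end Subdifferential

/-! ### Areas of rectangles and the transport inequality -/

section Rectangle

theorem isClosed_rectangle (c : Plane) (e : OrthonormalBasis (Fin 2) ℝ Plane) (a b : ℝ) :
    IsClosed (rectangle c e a b) := by
  have h : ∀ i, Continuous fun x : Plane => inner ℝ (e i) (x - c) := fun i => by fun_prop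
  exact (isClosed_Icc.preimage (h 0)).inter (isClosed_Icc.preimage (h 1))

theorem volume_rectangle (c : Plane) (e : OrthonormalBasis (Fin 2) ℝ Plane) (a b : ℝ) :
    volume (rectangle c e a b) = ENNReal.ofReal a * ENNReal.ofReal b := by
  have h0 : rectangle c e a b =
      (fun x => x - c) ⁻¹' (e.repr ⁻¹' (WithLp.ofLp ⁻¹' (Icc (0 : Fin 2 → ℝ) ![a, b]))) := by
    ext x
    simp only [rectangle, mem_ofPred_eq, mem_preimage, mem_Icc, Pi.le_def, Fin.forall_fin_two,
      OrthonormalBasis.repr_apply_apply]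
    simp
    tauto
  have hm : MeasurableSet (WithLp.ofLp ⁻¹' (Icc (0 : Fin 2 → ℝ) ![a, b]) : Set Plane) :=
    (WithLp.measurable_ofLp 2 _) measurableSet_Icc
  rw [h0, (measurePreserving_sub_right volume c).measure_preimage
      (e.measurePreserving_repr.measurable hm).nullMeasurableSet,
    e.measurePreserving_repr.measure_preimage hm.nullMeasurableSet,
    (PiLp.volume_preserving_ofLp (Fin 2)).measure_preimage measurableSet_Icc.nullMeasurableSet,
    Real.volume_Icc_pi]
  simp

/-- The only place where the measures enter: the two density bounds and the transport inequality
combine into a purely geometric comparison of areas, in which only the product `lam₁ * lam₂`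
remains. -/
theorem Admissible.mul_le {Ω : Set Plane} {μ ν : Measure Plane} {ψ : Plane → ℝ}
    {lam₁ lam₂ h₁ h₂ : ℝ} (H : Admissible Ω μ ν ψ lam₁ lam₂ h₁ h₂) {c c' : Plane}
    {e e' : OrthonormalBasis (Fin 2) ℝ Plane} {a b a' b' : ℝ} (ha : 0 < a) (hb : 0 < b)
    (h₁a : h₁ ≤ a) (h₁b : h₁ ≤ b) (ha' : 0 < a') (hb' : 0 < b') (h₂a : h₂ ≤ a') (h₂b : h₂ ≤ b')
    (hΩ : rectangle c e a b ⊆ Ω)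
    (himage : subdiffImage ψ (rectangle c e a b) ⊆ rectangle c' e' a' b') :
    a * b ≤ lam₁ * lam₂ * (a' * b') := by
  have h1 := H.lower c e a b ha hb h₁a h₁b hΩ
  have h2 := H.transport _ (isClosed_rectangle c e a b).measurableSet hΩ
  have h3 : ν (subdiffImage ψ (rectangle c e a b)) ≤
      ν (rectangle c' e' a' b' ∩ subdiffImage ψ Ω) :=
    measure_mono (subset_inter himage (biUnion_subset_biUnion_left hΩ))
  have h4 := ((h1.trans h2).trans h3).trans (H.upper c' e' a' b' ha' hb' h₂a h₂b)
  have hl1 := H.lam₁_pos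
  have hl2 := H.lam₂_pos
  rw [volume_rectangle, volume_rectangle, ← ENNReal.ofReal_mul ha.le, ← ENNReal.ofReal_mul ha'.le,
    ← ENNReal.ofReal_mul hl2.le, ← ENNReal.ofReal_div_of_pos hl1,
    ENNReal.ofReal_le_ofReal_iff (by positivity), div_le_iff₀ hl1] at h4
  linarith

end Rectangle

/-! ### Duality between `ψ` and its Legendre transform on `Ω` -/

section Legendre

variable {Ω : Set Plane} {ψ : Plane → ℝ}

theorem bddAbove_range_legendre (hψ : ConvexOn ℝ univ ψ) (hΩ : Bornology.IsBounded Ω) (z : Plane) :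
    BddAbove (range fun x : Ω => inner ℝ (x : Plane) z - ψ x) := by
  have hcont := continuous_of_convexOn hψ
  have : BddAbove ((fun x : Plane => inner ℝ x z - ψ x) '' closure Ω) :=
    hΩ.isCompact_closure.bddAbove_image (by fun_prop)
  refine this.mono ?_
  rintro _ ⟨x, rfl⟩
  exact ⟨x, subset_closure x.2, rfl⟩

theorem le_legendre (hψ : ConvexOn ℝ univ ψ) (hΩ : Bornology.IsBounded Ω) {x : Plane}
    (hx : x ∈ Ω) (z : Plane) : inner ℝ x z - ψ x ≤ legendre Ω ψ z :=
  le_ciSup (bddAbove_range_legendre hψ hΩ z) (⟨x, hx⟩ : Ω)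

theorem legendre_eq_of_mem_subdiff (hψ : ConvexOn ℝ univ ψ) (hΩ : Bornology.IsBounded Ω)
    {x z : Plane} (hx : x ∈ Ω) (hz : z ∈ subdiff ψ x) : legendre Ω ψ z = inner ℝ x z - ψ x := by
  refine le_antisymm ?_ (le_legendre hψ hΩ hx z)
  have : Nonempty Ω := ⟨⟨x, hx⟩⟩
  refine ciSup_le fun y => ?_
  have := hz y
  rw [inner_sub_right, real_inner_comm (y : Plane), real_inner_comm x] at this
  linarith

/-- A subgradient `x'` of the dual at `z'` bounds `ψ` from above on the part in `Ω` of the segment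
from any point of `Ω` to `x'`. -/
theorem le_of_mem_subdiff_legendre (hψ : ConvexOn ℝ univ ψ) (hΩ : Bornology.IsBounded Ω)
    {x₀ x' z' : Plane} (hx₀ : x₀ ∈ Ω) (hx' : x' ∈ subdiff (legendre Ω ψ) z') {t : ℝ}
    (ht : t ∈ Icc 0 1) (hy : x₀ + t • (x' - x₀) ∈ Ω) :
    ψ (x₀ + t • (x' - x₀)) ≤ ψ x₀ + t * inner ℝ z' (x' - x₀) := by
  obtain ⟨w, hw⟩ := subdiff_nonempty hψ (x₀ + t • (x' - x₀))
  have h1 := legendre_eq_of_mem_subdiff hψ hΩ hy hw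
  have h2 := hx' w
  have h3 := le_legendre hψ hΩ hx₀ z'
  have h4 := le_legendre hψ hΩ hx₀ w
  -- At `w ∈ ∂ψ(y)` the dual equals `y · w - ψ y`. It is bounded below through `x'` with weight `t`
  -- and through `x₀` with weight `1 - t`; the terms in `w` cancel. The endpoint `x'` need not lie
  -- in `Ω`.
  have h5 := mul_le_mul_of_nonneg_left (h2.trans' (add_le_add_left h3 _)) ht.1
  have h6 := mul_le_mul_of_nonneg_left h4 (sub_nonneg.2 ht.2)
  rw [inner_add_left, inner_smul_left] at h1
  simp only [inner_sub_left, inner_sub_right, conj_trivial] at *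
  rw [real_inner_comm z' x₀, real_inner_comm z' x'] at *
  linarith

/-- The dual grows in direction `v` at most at the rate `sup_Ω y · v`, which exceeds `x₀ · v` by at
most `diam Ω ‖v‖`. Testing with `v = x - x₀` gives the bound, although `x` may lie outside `Ω`. -/
theorem norm_sub_le_diam (hψ : ConvexOn ℝ univ ψ) (hΩ : Bornology.IsBounded Ω)
    {x₀ x z : Plane} (hx₀ : x₀ ∈ Ω) (hx : x ∈ subdiff (legendre Ω ψ) z) :
    ‖x - x₀‖ ≤ Metric.diam Ω := by
  have : Nonempty Ω := ⟨⟨x₀, hx₀⟩⟩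
  set v := x - x₀ with hv
  have h1 := hx (z + v)
  have h2 : legendre Ω ψ (z + v) ≤ legendre Ω ψ z + (inner ℝ x₀ v + Metric.diam Ω * ‖v‖) := by
    refine ciSup_le fun y => ?_
    have e1 := le_legendre hψ hΩ y.2 z
    have e2 : inner ℝ ((y : Plane) - x₀) v ≤ Metric.diam Ω * ‖v‖ := by
      refine (real_inner_le_norm _ _).trans ?_
      gcongr
      rw [← dist_eq_norm]
      exact Metric.dist_le_diam_of_mem hΩ y.2 hx₀
    rw [inner_sub_left] at e2
    rw [inner_add_right]
    linarith
  have h3 : inner ℝ v v ≤ Metric.diam Ω * ‖v‖ := by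
    nth_rewrite 1 [hv]
    rw [inner_sub_left]
    rw [add_sub_cancel_left] at h1
    linarith
  rw [real_inner_self_eq_norm_sq] at h3
  rcases eq_or_lt_of_le (norm_nonneg v) with h0 | h0
  · rw [← h0]; exact Metric.diam_nonneg
  · nlinarith

/-- A maximiser of `x · z - ψ x` over the compact closure of `Ω` is a subgradient, since `ψ` is
continuous. -/
theorem subdiff_legendre_nonempty (hψ : ConvexOn ℝ univ ψ) (hΩ : Bornology.IsBounded Ω)
    (hne : Ω.Nonempty) (z : Plane) : (subdiff (legendre Ω ψ) z).Nonempty := by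
  have hcont := continuous_of_convexOn hψ
  have : Nonempty Ω := hne.to_subtype
  obtain ⟨x, hx, hmax⟩ := hΩ.isCompact_closure.exists_isMaxOn hne.closure
    (f := fun x : Plane => inner ℝ x z - ψ x) (by fun_prop)
  refine ⟨x, fun w => ?_⟩
  have h1 : legendre Ω ψ z ≤ inner ℝ x z - ψ x := ciSup_le fun y => hmax (subset_closure y.2)
  have h2 : inner ℝ x w - ψ x ≤ legendre Ω ψ w := by
    have hcl : IsClosed {y : Plane | inner ℝ y w - ψ y ≤ legendre Ω ψ w} :=
      isClosed_le (by fun_prop) continuous_const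
    exact hcl.closure_subset_iff.2 (fun y hy => le_legendre hψ hΩ hy w) hx
  rw [inner_sub_right]
  linarith

/-- Duality gives the support inequality only against points of `Ω`. Since `x` is interior, it is a
local minimum of a convex function, hence a global one. -/
theorem mem_subdiff_of_mem_subdiff_legendre (hψ : ConvexOn ℝ univ ψ) (hΩo : IsOpen Ω)
    (hΩ : Bornology.IsBounded Ω) {x z : Plane} (hx : x ∈ Ω)
    (hxz : x ∈ subdiff (legendre Ω ψ) z) : z ∈ subdiff ψ x := by
  obtain ⟨w, hw⟩ := subdiff_nonempty hψ x
  have h1 := legendre_eq_of_mem_subdiff hψ hΩ hx hw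
  have h2 := hxz w
  have loc : ∀ y ∈ Ω, ψ x + inner ℝ z (y - x) ≤ ψ y := by
    intro y hy
    have h3 := le_legendre hψ hΩ hy z
    rw [inner_sub_right] at h2 ⊢
    rw [real_inner_comm y, real_inner_comm x]
    linarith
  have hconv : ConvexOn ℝ univ fun y : Plane => ψ y - inner ℝ z y := by
    refine hψ.sub ?_
    exact ((innerSL ℝ z).toLinearMap.concaveOn convex_univ)
  have hmin : IsLocalMin (fun y : Plane => ψ y - inner ℝ z y) x := by
    filter_upwards [hΩo.mem_nhds hx] with y hy
    have := loc y hy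
    rw [inner_sub_right] at this
    linarith
  intro y
  have := IsMinOn.of_isLocalMin_of_convex_univ hmin hconv y
  rw [inner_sub_right]
  linarith

end Legendre

/-! ### Orthonormal frames adapted to the segment -/

section Coordinates

/-- The point with coordinates `(t, y)` in the orthonormal frame `e` with origin `x₀`. -/
noncomputable def framePoint (x₀ : Plane) (e : OrthonormalBasis (Fin 2) ℝ Plane) (t y : ℝ) :
    Plane :=
  x₀ + (t • e 0 + y • e 1)

/-- The function `ψ` minus its affine part with slope `z` at `x₀`, in the frame `e`. -/
noncomputable def frameFun (ψ : Plane → ℝ) (x₀ z : Plane) (e : OrthonormalBasis (Fin 2) ℝ Plane)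
    (t y : ℝ) : ℝ :=
  ψ (framePoint x₀ e t y) - ψ x₀ - inner ℝ z (t • e 0 + y • e 1)

variable {ψ : Plane → ℝ} {x₀ z w : Plane} {e : OrthonormalBasis (Fin 2) ℝ Plane} {t y : ℝ}

theorem exists_orthonormalBasis_fst_eq {u : Plane} (hu : ‖u‖ = 1) :
    ∃ e : OrthonormalBasis (Fin 2) ℝ Plane, e 0 = u := by
  obtain ⟨b, hb⟩ := Orthonormal.exists_orthonormalBasis_extension_of_card_eq (𝕜 := ℝ) (E := Plane)
    (ι := Fin 2) (by simp) (v := fun _ => u) (s := {0})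
    ⟨fun _ => hu, fun i j hij => absurd (Subsingleton.elim i j) hij⟩
  exact ⟨b, hb 0 rfl⟩

theorem inner_frame_zero_zero : inner ℝ (e 0) (e 0) = (1 : ℝ) := by
  rw [real_inner_self_eq_norm_sq, e.norm_eq_one]; norm_num

theorem inner_frame_one_one : inner ℝ (e 1) (e 1) = (1 : ℝ) := by
  rw [real_inner_self_eq_norm_sq, e.norm_eq_one]; norm_num

theorem inner_frame_zero_one : inner ℝ (e 0) (e 1) = (0 : ℝ) := e.inner_eq_zero (by decide)

theorem inner_frame_one_zero : inner ℝ (e 1) (e 0) = (0 : ℝ) := e.inner_eq_zero (by decide)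

theorem framePoint_inner (x₀ x : Plane) (e : OrthonormalBasis (Fin 2) ℝ Plane) :
    framePoint x₀ e (inner ℝ (e 0) (x - x₀)) (inner ℝ (e 1) (x - x₀)) = x := by
  have := e.sum_repr' (x - x₀)
  rw [Fin.sum_univ_two] at this
  rw [framePoint, this, add_sub_cancel]

theorem framePoint_sub (t y t' y' : ℝ) : framePoint x₀ e t' y' - framePoint x₀ e t y =
    (t' - t) • e 0 + (y' - y) • e 1 := by
  unfold framePoint; module

theorem isSubgradientAt_frameFun (hw : w ∈ subdiff ψ (framePoint x₀ e t y)) :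
    IsSubgradientAt (frameFun ψ x₀ z e) t y (inner ℝ (e 0) (w - z)) (inner ℝ (e 1) (w - z)) := by
  intro t' y'
  have := hw (framePoint x₀ e t' y')
  rw [framePoint_sub] at this
  unfold frameFun
  simp only [inner_add_right, inner_smul_right, inner_sub_right] at this ⊢
  rw [real_inner_comm w, real_inner_comm w, real_inner_comm z, real_inner_comm z] at *
  linarith

theorem mem_subdiff_of_isSubgradientAt {p q : ℝ}
    (h : IsSubgradientAt (frameFun ψ x₀ z e) t y p q) :
    z + (p • e 0 + q • e 1) ∈ subdiff ψ (framePoint x₀ e t y) := by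
  intro x
  rw [← framePoint_inner x₀ x e]
  set t' := inner ℝ (e 0) (x - x₀)
  set y' := inner ℝ (e 1) (x - x₀)
  have := h t' y'
  rw [framePoint_sub]
  unfold frameFun at this
  simp only [inner_add_right, inner_add_left, inner_smul_right, inner_smul_left,
    inner_frame_zero_zero, inner_frame_zero_one, inner_frame_one_zero, inner_frame_one_one,
    conj_trivial] at this ⊢
  linarith

theorem norm_frame_le (t y : ℝ) : ‖t • e 0 + y • e 1‖ ≤ |t| + |y| := by
  refine (norm_add_le _ _).trans_eq ?_
  rw [norm_smul, norm_smul, e.norm_eq_one, e.norm_eq_one, Real.norm_eq_abs, Real.norm_eq_abs]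
  ring

theorem framePoint_mem_ball {d : ℝ} (hd : 0 < d) (ht : t ∈ Icc 0 d) (hy : y ∈ Icc 0 d) :
    framePoint x₀ e t y ∈ Metric.ball x₀ (3 * d) := by
  rw [Metric.mem_ball, dist_eq_norm, framePoint, add_sub_cancel_left]
  refine (norm_frame_le t y).trans_lt ?_
  rw [abs_of_nonneg ht.1, abs_of_nonneg hy.1]
  linarith [ht.2, hy.2]

theorem mem_rectangle_frame {p q p₀ q₀ A B : ℝ} (hp : p ∈ Icc p₀ (p₀ + A))
    (hq : q ∈ Icc q₀ (q₀ + B)) (hwp : inner ℝ (e 0) (w - z) = p)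
    (hwq : inner ℝ (e 1) (w - z) = q) :
    w ∈ rectangle (framePoint z e p₀ q₀) e A B := by
  simp only [rectangle, framePoint, mem_ofPred_eq, mem_Icc]
  rw [← sub_sub, inner_sub_right, inner_sub_right _ (w - z)]
  simp only [inner_add_right, inner_smul_right,
    inner_frame_zero_zero, inner_frame_zero_one, inner_frame_one_zero, inner_frame_one_one,
    hwp, hwq]
  obtain ⟨hp1, hp2⟩ := hp
  obtain ⟨hq1, hq2⟩ := hq
  refine ⟨⟨?_, ?_⟩, ?_, ?_⟩ <;> linarith

end Coordinates

/-! ### From level counting to closeness of dual subgradients -/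

namespace Admissible

variable {Ω : Set Plane} {μ ν : Measure Plane} {ψ : Plane → ℝ} {lam₁ lam₂ h₁ h₂ : ℝ}

/-- Transfers the planar count to `ψ` in the frame whose first axis points from `x₀` to `x'`.
Almost-vanishing on the axis is the duality bound on the segment, and the area hypothesis is the
transport inequality. -/
theorem level_count_le (H : Admissible Ω μ ν ψ lam₁ lam₂ h₁ h₂) {x₀ z x' z' : Plane}
    {d K s r₀ : ℝ} (hd : 0 < d) (hball : Metric.ball x₀ (3 * d) ⊆ Ω) (hz : z ∈ subdiff ψ x₀)
    (hx' : x' ∈ subdiff (legendre Ω ψ) z') (hK : 0 < K)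
    (hKsub : ∀ y ∈ Metric.ball x₀ (3 * d), ∀ w ∈ subdiff ψ y, ‖w - z‖ ≤ K)
    (hs : 0 < s) (hsd : s ≤ d) (hsx : s ≤ ‖x' - x₀‖) (hr₀ : 0 < r₀)
    (hε : ‖z - z'‖ * s ≤ K * r₀) {n M : ℕ} (hn : 8640 * (lam₁ * lam₂) * K ^ 2 ≤ n * s ^ 2)
    (hM : 4 ^ M * r₀ ≤ d) (h₁s : h₁ ≤ s / 2) (h₁r : h₁ ≤ r₀) (h₂r : h₂ ≤ 40 * K * r₀ / s)
    (h₂n : h₂ ≤ 54 * K / n) :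
    M * s ^ 2 ≤ 1920 * (lam₁ * lam₂) * K ^ 2 * (n + 1) := by
  have hx₀ : x₀ ∈ Ω := hball (Metric.mem_ball_self (by positivity))
  set N := ‖x' - x₀‖ with hN
  have hN0 : 0 < N := hs.trans_le hsx
  obtain ⟨e, he⟩ := exists_orthonormalBasis_fst_eq (u := N⁻¹ • (x' - x₀))
    (by rw [norm_smul, norm_inv, hN, norm_norm]; exact inv_mul_cancel₀ hN0.ne')
  have hz0 : ∀ w, inner ℝ w (x' - x₀) = N * inner ℝ w (e 0) := fun w => by
    rw [he, inner_smul_right]; field_simp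
  refine _root_.level_count_le (F := frameFun ψ x₀ z e) (d := d) (h₁ := h₁) (h₂ := h₂) hs hK hr₀
    (mul_pos H.lam₁_pos H.lam₂_pos) ?_ ?_ ?_ ?_ ?_ hn hM h₁s h₁r h₂r h₂n
  · intro t y
    obtain ⟨w, hw⟩ := subdiff_nonempty H.convex (framePoint x₀ e t y)
    exact ⟨_, _, isSubgradientAt_frameFun hw⟩
  · intro t y
    have := hz (framePoint x₀ e t y)
    unfold frameFun
    rw [framePoint, add_sub_cancel_left] at *
    linarith
  · intro t ht
    have hφ : framePoint x₀ e t 0 = x₀ + (t / N) • (x' - x₀) := by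
      rw [framePoint, he, smul_smul, zero_smul, add_zero, div_eq_mul_inv]
    have hmem : framePoint x₀ e t 0 ∈ Ω :=
      hball (framePoint_mem_ball hd ⟨ht.1, ht.2.trans hsd⟩ ⟨le_rfl, hd.le⟩)
    have ht1 : t / N ∈ Icc (0 : ℝ) 1 :=
      ⟨div_nonneg ht.1 hN0.le, (div_le_one hN0).2 (ht.2.trans hsx)⟩
    have h1 := le_of_mem_subdiff_legendre H.convex H.isBounded hx₀ hx' ht1 (hφ ▸ hmem)
    rw [hz0, ← mul_assoc, div_mul_cancel₀ _ hN0.ne'] at h1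
    unfold frameFun
    rw [hφ, zero_smul, add_zero, inner_smul_right]
    have h2 : inner ℝ (z' - z) (e 0) ≤ ‖z - z'‖ := by
      have := real_inner_le_norm (z' - z) (e 0)
      rwa [e.norm_eq_one, mul_one, norm_sub_rev] at this
    rw [inner_sub_left] at h2
    have h3 : t * (inner ℝ z' (e 0) - inner ℝ z (e 0)) ≤ s * ‖z - z'‖ :=
      (mul_le_mul_of_nonneg_left h2 ht.1).trans (mul_le_mul_of_nonneg_right ht.2 (norm_nonneg _))
    linarith
  · intro t ht y hy p q hpq
    have h1 := hKsub _ (framePoint_mem_ball hd ⟨ht.1, ht.2.trans hsd⟩ hy) _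
      (mem_subdiff_of_isSubgradientAt hpq)
    rw [add_sub_cancel_left] at h1
    have h2 := abs_real_inner_le_norm (e 1) (p • e 0 + q • e 1)
    rw [e.norm_eq_one, one_mul, inner_add_right, inner_smul_right, inner_smul_right,
      inner_frame_one_zero, inner_frame_one_one, mul_zero, mul_one, zero_add] at h2
    exact h2.trans h1
  · intro c₁ d₁ c₂ d₂ p₀ q₀ A B hc₁ hd₁ hc₂ hd₂ h1 h2 h11 h12 hA hB h2A h2B hsub
    have coord : ∀ x ∈ rectangle (framePoint x₀ e c₁ c₂) e (d₁ - c₁) (d₂ - c₂),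
        ∃ t ∈ Icc c₁ d₁, ∃ y ∈ Icc c₂ d₂, x = framePoint x₀ e t y := by
      rintro x ⟨hx1, hx2⟩
      refine ⟨inner ℝ (e 0) (x - x₀), ?_, inner ℝ (e 1) (x - x₀), ?_, (framePoint_inner x₀ x e).symm⟩
      · rw [framePoint, ← sub_sub, inner_sub_right, inner_add_right, inner_smul_right,
          inner_smul_right, inner_frame_zero_zero, inner_frame_zero_one] at hx1
        constructor <;> linarith [hx1.1, hx1.2]
      · rw [framePoint, ← sub_sub, inner_sub_right, inner_add_right, inner_smul_right,
          inner_smul_right, inner_frame_one_zero, inner_frame_one_one] at hx2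
        constructor <;> linarith [hx2.1, hx2.2]
    refine H.mul_le (c := framePoint x₀ e c₁ c₂) (e := e) (c' := framePoint z e p₀ q₀) (e' := e)
      (sub_pos.2 h1) (sub_pos.2 h2) h11 h12 hA hB h2A h2B ?_ ?_
    · intro x hx
      obtain ⟨t, ht, y, hy, rfl⟩ := coord x hx
      exact hball (framePoint_mem_ball hd ⟨hc₁.trans ht.1, (ht.2.trans hd₁).trans hsd⟩
        ⟨hc₂.trans hy.1, hy.2.trans hd₂⟩)
    · intro w hw
      simp only [subdiffImage, mem_iUnion] at hw
      obtain ⟨x, hx, hw⟩ := hw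
      obtain ⟨t, ht, y, hy, rfl⟩ := coord x hx
      obtain ⟨hp, hq⟩ := hsub t ht y hy _ _ (isSubgradientAt_frameFun hw)
      exact mem_rectangle_frame hp hq rfl rfl

/-- At distance `3 d` from the boundary, points `x₀` and `x'` are close to each other when a
subgradient of `ψ` at `x₀` and a point at which `x'` is a subgradient of the dual are close, and
the scales `h₁` and `h₂` are small. -/
theorem exists_norm_sub_lt (Λ : ℝ) {d K s : ℝ} (hd : 0 < d) (hK : 0 < K) (hs : 0 < s) :
    ∃ η > 0, ∀ (Ω : Set Plane) (μ ν : Measure Plane) (ψ : Plane → ℝ) (lam₁ lam₂ h₁ h₂ : ℝ),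
      Admissible Ω μ ν ψ lam₁ lam₂ h₁ h₂ → lam₁ * lam₂ = Λ → h₁ < η → h₂ < η →
      ∀ x₀ z x' z' : Plane, Metric.ball x₀ (3 * d) ⊆ Ω → z ∈ subdiff ψ x₀ →
        (∀ y ∈ Metric.ball x₀ (3 * d), ∀ w ∈ subdiff ψ y, ‖w - z‖ ≤ K) →
        x' ∈ subdiff (legendre Ω ψ) z' → ‖z - z'‖ < η → ‖x' - x₀‖ < s := by
  -- For `s > d` the conclusion at scale `d` is stronger.
  wlog hsd : s ≤ d generalizing s
  · obtain ⟨η, hη, h⟩ := this hd le_rfl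
    refine ⟨η, hη, fun Ω μ ν ψ lam₁ lam₂ h₁ h₂ H hΛ hh₁ hh₂ x₀ z x' z' hb hz hKs hx' hzz => ?_⟩
    exact (h Ω μ ν ψ lam₁ lam₂ h₁ h₂ H hΛ hh₁ hh₂ x₀ z x' z' hb hz hKs hx' hzz).trans
      (not_le.1 hsd)
  obtain ⟨n, hn⟩ := exists_nat_ge (8640 * Λ * K ^ 2 / s ^ 2 + 1)
  have hn0 : 8640 * Λ * K ^ 2 ≤ n * s ^ 2 := by
    rw [← div_le_iff₀ (by positivity)]; linarith
  obtain ⟨M, hM⟩ := exists_nat_gt (1920 * Λ * K ^ 2 * (n + 1) / s ^ 2)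
  rw [div_lt_iff₀ (by positivity)] at hM
  -- `M` is chosen to violate the level count, and `r₀` so that exactly `M` levels fit below `d`;
  -- `η` then collects every smallness condition that the count requires.
  set r₀ := d / 4 ^ M with hr
  have hr₀ : 0 < r₀ := by positivity
  have hn1 : 54 * K / (n + 1) ≤ 54 * K / n ∨ n = 0 := by
    rcases Nat.eq_zero_or_pos n with h | h
    · exact Or.inr h
    · left
      have : (0 : ℝ) < n := by exact_mod_cast h
      gcongr; linarith
  -- `n + 1` keeps `η` positive: `n = 0` is excluded only once `Λ > 0` is known from an admissible
  -- configuration.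
  refine ⟨min (min (K * r₀ / s) (s / 2)) (min r₀ (min (40 * K * r₀ / s) (54 * K / (n + 1)))),
    by positivity, ?_⟩
  intro Ω μ ν ψ lam₁ lam₂ h₁ h₂ H hΛ hh₁ hh₂ x₀ z x' z' hb hz hKs hx' hzz
  simp only [lt_min_iff] at hh₁ hh₂ hzz
  by_contra! hc
  have hΛ0 : 0 < Λ := hΛ ▸ mul_pos H.lam₁_pos H.lam₂_pos
  have hnn : n ≠ 0 := by
    rintro rfl
    have : 0 < 8640 * Λ * K ^ 2 := by positivity
    simp at hn0; linarith
  have := H.level_count_le (n := n) (M := M) hd hb hz hx' hK hKs hs hsd hc hr₀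
    (by rw [← le_div_iff₀ hs]; exact hzz.1.1.le) (by rw [hΛ]; exact hn0)
    (by rw [hr]; exact le_of_eq (by field_simp)) hh₁.1.2.le hh₁.2.1.le hh₂.2.2.1.le
    (hh₂.2.2.2.le.trans (hn1.resolve_right hnn))
  rw [hΛ] at this
  linarith

end Admissible

/-! ### The moduli of continuity -/

/-- Bounds at every scale define a modulus. -/
theorem exists_isModulus (D : ℝ) {η : ℝ → ℝ} (hη : ∀ s > 0, 0 < η s) :
    ∃ ρ, IsModulus ρ ∧ ∀ t, 0 ≤ t → ∀ u, u ≤ D → (∀ s > 0, t < η s → u ≤ s) → u ≤ ρ t := by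
  -- The modulus is the infimum of the scales available at `t`. These sets shrink as `t` grows, so
  -- no monotonicity of `η` is needed, and the alternative `D ≤ s` keeps them nonempty.
  let S : ℝ → Set ℝ := fun t => {s | 0 < s ∧ (D ≤ s ∨ t < η s)}
  have hne : ∀ t, (S t).Nonempty := fun t => ⟨max D 1, by simp [S]⟩
  have hbdd : ∀ t, BddBelow (S t) := fun t => ⟨0, fun s hs => hs.1.le⟩
  have hpos : ∀ t, 0 ≤ sInf (S t) := fun t => le_csInf (hne t) fun s hs => hs.1.le
  refine ⟨fun t => sInf (S t), ⟨?_, ?_, ?_⟩, ?_⟩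
  · intro t _ t' _ htt
    exact csInf_le_csInf (hbdd t) (hne t') fun s hs => ⟨hs.1, hs.2.imp_right htt.trans_lt⟩
  · refine le_antisymm (le_of_forall_pos_le_add fun s hs => ?_) (hpos 0)
    rw [zero_add]
    exact csInf_le (hbdd 0) ⟨hs, Or.inr (hη s hs)⟩
  · rw [Metric.tendsto_nhds]
    intro s hs
    filter_upwards [mem_nhdsWithin_of_mem_nhds (Iio_mem_nhds (hη (s / 2) (by positivity)))]
      with t ht
    rw [Real.dist_eq, sub_zero, abs_of_nonneg (hpos t)]
    have := csInf_le (hbdd t) ⟨half_pos hs, Or.inr ht⟩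
    linarith
  · intro t _ u huD hu
    refine le_csInf (hne t) fun s hs => ?_
    exact hs.2.elim huD.trans (hu s hs.1)

/-- Both `x` and `x'` are compared with a point `x₀` satisfying `z ∈ ∂ψ(x₀)`, each to within `s /
2`. One modulus serves all three roles, since a monotone function commutes with `max`. -/
theorem exists_moduli {δ : ℝ} (Λ D K : ℝ) (hδ : 0 < δ) :
    ∃ ρ ρ₁ ρ₂ : ℝ → ℝ, IsModulus ρ ∧ IsModulus ρ₁ ∧ IsModulus ρ₂ ∧
      ∀ (Ω : Set Plane) (μ ν : Measure Plane) (ψ : Plane → ℝ) (lam₁ lam₂ h₁ h₂ : ℝ),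
        Admissible Ω μ ν ψ lam₁ lam₂ h₁ h₂ →
        lam₁ * lam₂ = Λ →
        Metric.diam Ω = D →
        (∀ x ∈ innerSet Ω δ, ∀ y ∈ innerSet Ω δ, segmentNhd x y δ ⊆ Ω →
          Metric.diam (subdiffImage ψ (segmentNhd x y δ)) ≤ K) →
        ∀ z ∈ subdiffImage ψ (innerSet Ω δ), ∀ z' ∈ subdiffImage ψ (innerSet Ω δ),
          ∀ x ∈ subdiff (legendre Ω ψ) z, ∀ x' ∈ subdiff (legendre Ω ψ) z',
            ‖x - x'‖ ≤ max (ρ ‖z - z'‖) (max (ρ₁ h₁) (ρ₂ h₂)) := by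
  have hd : 0 < δ / 3 := by positivity
  have hK : 0 < max K 1 := by positivity
  have hex := fun s : {s : ℝ // 0 < s} =>
    Admissible.exists_norm_sub_lt Λ hd hK (half_pos s.2)
  choose η hη hlt using hex
  obtain ⟨ρ, hρ, hρu⟩ := exists_isModulus (D + D)
    (η := fun s => if h : 0 < s then η ⟨s, h⟩ else 1) (by intro s hs; simp [hs, hη])
  refine ⟨ρ, ρ, ρ, hρ, hρ, hρ, ?_⟩
  intro Ω μ ν ψ lam₁ lam₂ h₁ h₂ H hΛ hD hKd z hz z' hz' x hx x' hx'
  simp only [subdiffImage, mem_iUnion] at hz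
  obtain ⟨x₀, hx₀, hz⟩ := hz
  set τ := max ‖z - z'‖ (max h₁ h₂) with hτ
  have hτ0 : 0 ≤ τ := le_max_of_le_left (norm_nonneg _)
  have hmax : ρ τ = max (ρ ‖z - z'‖) (max (ρ h₁) (ρ h₂)) := by
    have hh1 := H.h₁_nonneg
    have hh2 := H.h₂_nonneg
    rw [hτ, hρ.1.map_max (norm_nonneg _) (le_max_of_le_left hh1), hρ.1.map_max hh1 hh2]
  rw [← hmax]
  have htri : ‖x - x'‖ ≤ ‖x - x₀‖ + ‖x' - x₀‖ := by
    rw [norm_sub_rev x' x₀]; exact norm_sub_le_norm_sub_add_norm_sub x x₀ x'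
  have hball : Metric.ball x₀ (3 * (δ / 3)) ⊆ Ω := by
    rw [mul_div_cancel₀ _ (three_ne_zero)]; exact ball_subset_of_mem_innerSet H.isOpen hx₀
  -- The diameter bound is applied to the degenerate segment, whose neighbourhood is a ball.
  have hseg : segmentNhd x₀ x₀ δ = Metric.ball x₀ (3 * (δ / 3)) := by
    rw [mul_div_cancel₀ _ (three_ne_zero)]; simp [segmentNhd]
  have hKsub : ∀ y ∈ Metric.ball x₀ (3 * (δ / 3)), ∀ w ∈ subdiff ψ y, ‖w - z‖ ≤ max K 1 := by
    intro y hy w hw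
    have h1 := hKd x₀ hx₀ x₀ hx₀ (hseg ▸ hball)
    rw [hseg] at h1
    rw [← dist_eq_norm]
    refine (Metric.dist_le_diam_of_mem (isBounded_subdiffImage H.convex Metric.isBounded_ball)
      (mem_subdiffImage hy hw)
      (mem_subdiffImage (Metric.mem_ball_self (by positivity)) hz)).trans (h1.trans (le_max_left _ _))
  refine hρu τ hτ0 _ ?_ ?_
  · rw [← hD]
    exact htri.trans (add_le_add (norm_sub_le_diam H.convex H.isBounded hx₀.1 hx)
      (norm_sub_le_diam H.convex H.isBounded hx₀.1 hx'))
  · intro s hs hts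
    rw [dif_pos hs] at hts
    simp only [hτ, max_lt_iff] at hts
    have key := hlt ⟨s, hs⟩ Ω μ ν ψ lam₁ lam₂ h₁ h₂ H hΛ hts.2.1 hts.2.2 x₀ z
    have e1 := key x z hball hz hKsub hx (by simpa using hη _)
    have e2 := key x' z' hball hz hKsub hx' hts.1
    simp only at e1 e2
    linarith

/-! ### Continuous differentiability of the dual -/

section DualRegularity

variable {Ω : Set Plane} {μ ν : Measure Plane} {ψ : Plane → ℝ} {lam₁ lam₂ δ : ℝ}

/-- Subgradients of the dual at points near a subgradient of `ψ` at `x₀` are near `x₀`. -/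
theorem Admissible.eventually_norm_sub_lt (H : Admissible Ω μ ν ψ lam₁ lam₂ 0 0) (hδ : 0 < δ)
    {x₀ z : Plane} (hx₀ : x₀ ∈ innerSet Ω δ) (hz : z ∈ subdiff ψ x₀) {s : ℝ} (hs : 0 < s) :
    ∀ᶠ z' in 𝓝 z, ∀ x' ∈ subdiff (legendre Ω ψ) z', ‖x' - x₀‖ < s := by
  have hball : Metric.ball x₀ (3 * (δ / 3)) ⊆ Ω := by
    rw [mul_div_cancel₀ _ (three_ne_zero)]; exact ball_subset_of_mem_innerSet H.isOpen hx₀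
  have hbdd := isBounded_subdiffImage H.convex (Metric.isBounded_ball (x := x₀) (r := 3 * (δ / 3)))
  obtain ⟨η, hη, h⟩ := Admissible.exists_norm_sub_lt (lam₁ * lam₂) (d := δ / 3)
    (K := Metric.diam (subdiffImage ψ (Metric.ball x₀ (3 * (δ / 3)))) + 1) (by positivity)
    (by positivity) hs
  filter_upwards [Metric.ball_mem_nhds z hη] with z' hz' x' hx'
  refine h Ω μ ν ψ lam₁ lam₂ 0 0 H rfl hη hη x₀ z x' z' hball hz ?_ hx' ?_
  · intro y hy w hw
    rw [← dist_eq_norm]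
    have := Metric.dist_le_diam_of_mem hbdd (mem_subdiffImage hy hw)
      (mem_subdiffImage (Metric.mem_ball_self (by positivity)) hz)
    linarith
  · rwa [Metric.mem_ball, dist_comm, dist_eq_norm] at hz'

/-- The dual has the gradient `x₀` at every subgradient of `ψ` at `x₀`. -/
theorem Admissible.hasGradientAt_legendre (H : Admissible Ω μ ν ψ lam₁ lam₂ 0 0) (hδ : 0 < δ)
    {x₀ z : Plane} (hx₀ : x₀ ∈ innerSet Ω δ) (hz : z ∈ subdiff ψ x₀) :
    HasGradientAt (legendre Ω ψ) x₀ z := by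
  rw [hasGradientAt_iff_isLittleO, Asymptotics.isLittleO_iff]
  intro s hs
  filter_upwards [H.eventually_norm_sub_lt hδ hx₀ hz hs] with z' hz'
  obtain ⟨x', hx'⟩ := subdiff_legendre_nonempty H.convex H.isBounded ⟨x₀, hx₀.1⟩ z'
  have h1 := hx' z
  have h2 := legendre_eq_of_mem_subdiff H.convex H.isBounded hx₀.1 hz
  have h3 := le_legendre H.convex H.isBounded hx₀.1 z'
  have h4 := (real_inner_le_norm (x' - x₀) (z' - z)).trans
    (mul_le_mul_of_nonneg_right (hz' x' hx').le (norm_nonneg _))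
  rw [Real.norm_eq_abs, abs_le]
  simp only [inner_sub_left, inner_sub_right] at *
  constructor
  · have : 0 ≤ s * ‖z' - z‖ := by positivity
    linarith
  · linarith

theorem Admissible.contDiffAt_legendre (H : Admissible Ω μ ν ψ lam₁ lam₂ 0 0) (hδ : 0 < δ)
    {z : Plane} (hz : z ∈ subdiffImage ψ (innerSet Ω δ)) : ContDiffAt ℝ 1 (legendre Ω ψ) z := by
  have hne : Ω.Nonempty := by
    simp only [subdiffImage, mem_iUnion] at hz
    obtain ⟨x₀, hx₀, -⟩ := hz
    exact ⟨x₀, hx₀.1⟩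
  choose G hG using subdiff_legendre_nonempty H.convex H.isBounded hne
  have hmain : ∀ w ∈ subdiffImage ψ (innerSet Ω δ), HasGradientAt (legendre Ω ψ) (G w) w ∧
      ContinuousAt G w ∧ G w ∈ innerSet Ω δ := by
    intro w hw
    simp only [subdiffImage, mem_iUnion] at hw
    obtain ⟨x₀, hx₀, hw⟩ := hw
    have hx : G w = x₀ := by
      refine sub_eq_zero.1 (norm_le_zero_iff.1 (le_of_forall_pos_le_add fun s hs => ?_))
      rw [zero_add]
      exact ((H.eventually_norm_sub_lt hδ hx₀ hw hs).self_of_nhds _ (hG w)).le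
    refine ⟨hx ▸ H.hasGradientAt_legendre hδ hx₀ hw, ?_, hx ▸ hx₀⟩
    rw [Metric.continuousAt_iff']
    intro s hs
    filter_upwards [H.eventually_norm_sub_lt hδ hx₀ hw hs] with w' hw'
    rw [dist_eq_norm, hx]
    exact hw' _ (hG w')
  rw [contDiffAt_one_iff]
  refine ⟨fun w => InnerProductSpace.toDual ℝ Plane (G w), subdiffImage ψ (innerSet Ω δ), ?_, ?_,
    fun w hw => (hmain w hw).1.hasFDerivAt⟩
  · obtain ⟨-, hc, hmem⟩ := hmain z hz
    filter_upwards [hc.eventually_mem ((isOpen_innerSet H.isOpen δ).mem_nhds hmem)] with w hw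
    exact mem_subdiffImage hw
      (mem_subdiff_of_mem_subdiff_legendre H.convex H.isOpen H.isBounded hw.1 (hG w))
  · intro w hw
    exact ((InnerProductSpace.toDual ℝ Plane).continuous.continuousAt.comp
      (hmain w hw).2.1).continuousWithinAt

end DualRegularity

namespace Admissible

variable {Ω : Set Plane} {μ ν : Measure Plane} {ψ : Plane → ℝ} {lam₁ lam₂ d : ℝ}

/-- The gradients of `ψ` fill an area comparable to that of the domain. -/
theorem le_sqrt_mul_lipschitz (H : Admissible Ω μ ν ψ lam₁ lam₂ 0 0) (hd : 0 < d) {x₀ : Plane}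
    (hball : Metric.ball x₀ (3 * d) ⊆ Ω) {L : NNReal} (hL : LipschitzOnWith L ψ Ω) :
    d ≤ √(lam₁ * lam₂) * (2 * L) := by
  have hΛ := mul_pos H.lam₁_pos H.lam₂_pos
  have key : ∀ L' : ℝ, 0 < L' → L ≤ L' → d ≤ √(lam₁ * lam₂) * (2 * L') := by
    intro L' hL' hLL
    let e : OrthonormalBasis (Fin 2) ℝ Plane := EuclideanSpace.basisFun (Fin 2) ℝ
    have hsub : rectangle x₀ e d d ⊆ Ω := by
      rintro x ⟨h1, h2⟩
      rw [← framePoint_inner x₀ x e]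
      exact hball (framePoint_mem_ball hd h1 h2)
    have h := H.mul_le (c' := framePoint 0 e (-L') (-L')) (e' := e) hd hd hd.le hd.le
      (a' := 2 * L') (b' := 2 * L')
      (by positivity) (by positivity) (by positivity) (by positivity) hsub (by
        intro w hw
        simp only [subdiffImage, mem_iUnion] at hw
        obtain ⟨x, hx, hw⟩ := hw
        have hn := (norm_le_of_mem_subdiff_of_lipschitzOnWith H.isOpen hL (hsub hx) hw).trans hLL
        have hi : ∀ i, |inner ℝ (e i) (w - 0)| ≤ L' := fun i => by
          refine (abs_real_inner_le_norm _ _).trans ?_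
          rwa [e.norm_eq_one, one_mul, sub_zero]
        have h0 := abs_le.1 (hi 0)
        have h1 := abs_le.1 (hi 1)
        exact mem_rectangle_frame (z := 0) ⟨h0.1, by linarith⟩ ⟨h1.1, by linarith⟩ rfl rfl)
    refine abs_le_of_sq_le_sq' ?_ (by positivity) |>.2
    rw [mul_pow, Real.sq_sqrt hΛ.le]
    linarith
  refine le_of_forall_pos_le_add fun η hη => ?_
  have hS : 0 < √(lam₁ * lam₂) := Real.sqrt_pos.2 hΛ
  have h := key (L + η / (2 * √(lam₁ * lam₂))) (by positivity)
    (by have : 0 < η / (2 * √(lam₁ * lam₂)) := by positivity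
        linarith)
  have : √(lam₁ * lam₂) * (2 * (L + η / (2 * √(lam₁ * lam₂)))) =
      √(lam₁ * lam₂) * (2 * L) + η := by field_simp
  linarith

/-- The logarithmic bound for the length `s` of the segment. -/
theorem log_rpow_le (H : Admissible Ω μ ν ψ lam₁ lam₂ 0 0) (hd : 0 < d) {x₀ z x' z' : Plane}
    (hball : Metric.ball x₀ (3 * d) ⊆ Ω) {L : NNReal} (hL : LipschitzOnWith L ψ Ω)
    (hz : z ∈ subdiff ψ x₀) (hx' : x' ∈ subdiff (legendre Ω ψ) z') (hzz : z ≠ z') {s : ℝ}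
    (hs : 0 < s) (hsd : s ≤ d) (hsx : s ≤ ‖x' - x₀‖) :
    s * Real.log (1 + d / (√(lam₁ * lam₂) * ‖z - z'‖)) ^ (1 / 8 : ℝ) ≤
      20 * (√(lam₁ * lam₂) * L) := by
  have hΛ := mul_pos H.lam₁_pos H.lam₂_pos
  have hdL := H.le_sqrt_mul_lipschitz hd hball hL
  set S := √(lam₁ * lam₂) with hSdef
  have hS : 0 < S := Real.sqrt_pos.2 hΛ
  have hS2 : S ^ 2 = lam₁ * lam₂ := Real.sq_sqrt hΛ.le
  set ε := ‖z - z'‖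
  have hε : 0 < ε := norm_pos_iff.2 (sub_ne_zero.2 hzz)
  set K : ℝ := 2 * L with hKdef
  have hK : 0 < K := by
    by_contra! h
    nlinarith
  set T := S * K / s with hT
  have hT1 : 1 ≤ T := by rw [hT, le_div_iff₀ hs]; linarith
  have hTs : T * s = S * K := by rw [hT]; field_simp
  have hTs2 : lam₁ * lam₂ * K ^ 2 = T ^ 2 * s ^ 2 := by rw [← hS2, ← mul_pow, ← mul_pow, hTs]
  have hx₀ : x₀ ∈ Ω := hball (Metric.mem_ball_self (by positivity))
  have hKsub : ∀ y ∈ Metric.ball x₀ (3 * d), ∀ w ∈ subdiff ψ y, ‖w - z‖ ≤ K := by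
    intro y hy w hw
    have h1 := norm_le_of_mem_subdiff_of_lipschitzOnWith H.isOpen hL (hball hy) hw
    have h2 := norm_le_of_mem_subdiff_of_lipschitzOnWith H.isOpen hL hx₀ hz
    linarith [norm_sub_le w z]
  have hM : ∃ M : ℕ, K / ε ≤ 4 ^ (M + 1) ∧ M ≤ 1920 * 8642 * T ^ 4 := by
    rcases le_or_gt 1 (K * d / (ε * s)) with h1 | h1
    · obtain ⟨M, hM1, hM2⟩ := exists_nat_pow_near h1 (by norm_num : (1 : ℝ) < 4)
      refine ⟨M, ?_, ?_⟩
      · refine le_trans ?_ hM2.le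
        rw [div_le_div_iff₀ hε (by positivity)]
        have := mul_le_mul_of_nonneg_left hsd (mul_pos hK hε).le
        linarith
      · obtain ⟨n, hn1, hn2⟩ : ∃ n : ℕ, 8640 * T ^ 2 ≤ n ∧ (n : ℝ) ≤ 8640 * T ^ 2 + 1 :=
          ⟨_, Nat.le_ceil _, (Nat.ceil_lt_add_one (by positivity)).le⟩
        have := H.level_count_le (r₀ := ε * s / K) (n := n) (M := M) hd hball hz hx' hK hKsub hs
          hsd hsx (by positivity) (by rw [mul_div_cancel₀ _ hK.ne'])
          (by
            have := mul_le_mul_of_nonneg_right hn1 (sq_nonneg s)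
            linarith)
          (by
            rw [le_div_iff₀ (by positivity)] at hM1
            rw [mul_div_assoc', div_le_iff₀ hK]
            linarith)
          (by positivity) (by positivity) (by positivity) (by positivity)
        have h2 : (M : ℝ) ≤ 1920 * T ^ 2 * (n + 1) := by
          refine le_of_mul_le_mul_right ?_ (pow_pos hs 2)
          calc M * s ^ 2 ≤ 1920 * (lam₁ * lam₂ * K ^ 2) * (n + 1) := by linarith
            _ = _ := by rw [hTs2]; ring
        have h3 : (1 : ℝ) ≤ T ^ 2 := one_le_pow₀ hT1
        calc (M : ℝ) ≤ 1920 * T ^ 2 * (n + 1) := h2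
          _ ≤ 1920 * T ^ 2 * (8642 * T ^ 2) := by gcongr; linarith
          _ = _ := by ring
    · refine ⟨0, ?_, by simp; positivity⟩
      have : K / ε ≤ K * d / (ε * s) := by
        rw [div_le_div_iff₀ hε (by positivity)]
        have := mul_le_mul_of_nonneg_left hsd (mul_pos hK hε).le
        linarith
      norm_num; linarith
  obtain ⟨M, hM1, hM2⟩ := hM
  have hlog : Real.log (1 + d / (S * ε)) ≤ (10 * T) ^ 8 := by
    have h1 : d / (S * ε) ≤ K / ε := by
      rw [div_le_div_iff₀ (by positivity) hε]
      have := mul_le_mul_of_nonneg_right hdL hε.le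
      linarith
    have h2 : 1 + d / (S * ε) ≤ 4 ^ (M + 2) := by
      have : (1 : ℝ) ≤ 4 ^ (M + 1) := one_le_pow₀ (by norm_num)
      rw [pow_succ]; linarith
    have h3 : Real.log 4 ≤ 2 := by
      rw [show (4 : ℝ) = 2 ^ 2 by norm_num, Real.log_pow]
      have := Real.log_two_lt_d9
      push_cast; linarith
    have h4 : (1 : ℝ) ≤ T ^ 4 := one_le_pow₀ hT1
    calc Real.log (1 + d / (S * ε)) ≤ Real.log (4 ^ (M + 2)) :=
          Real.log_le_log (by positivity) h2
      _ = (M + 2) * Real.log 4 := by rw [Real.log_pow]; push_cast; ring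
      _ ≤ (M + 2) * 2 := by gcongr
      _ ≤ 40000000 * T ^ 4 := by linarith
      _ ≤ 10 ^ 8 * (T ^ 4 * T ^ 4) := by nlinarith
      _ = _ := by ring
  have hrp : Real.log (1 + d / (S * ε)) ^ (1 / 8 : ℝ) ≤ 10 * T := by
    have h0 : 0 ≤ Real.log (1 + d / (S * ε)) := Real.log_nonneg (by
      have : 0 < d / (S * ε) := by positivity
      linarith)
    calc _ ≤ ((10 * T) ^ 8) ^ (1 / 8 : ℝ) := Real.rpow_le_rpow h0 hlog (by norm_num)
      _ = 10 * T := by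
        have := Real.pow_rpow_inv_natCast (x := 10 * T) (n := 8) (by positivity) (by norm_num)
        simpa using this
  calc _ ≤ s * (10 * T) := by gcongr
    _ = 10 * (T * s) := by ring
    _ = _ := by rw [hTs, hKdef]; ring

end Admissible

theorem exists_gradient_legendre_bound {δ : ℝ} (D : ℝ) (hδ : 0 < δ) :
    ∃ C : ℝ, 0 < C ∧
      ∀ (Ω : Set Plane) (μ ν : Measure Plane) (ψ : Plane → ℝ) (lam₁ lam₂ : ℝ),
        Admissible Ω μ ν ψ lam₁ lam₂ 0 0 →
        Metric.diam Ω = D →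
        ∀ L : NNReal, LipschitzOnWith L ψ Ω →
          ∀ z ∈ subdiffImage ψ (innerSet Ω δ), ∀ z' ∈ subdiffImage ψ (innerSet Ω δ), z ≠ z' →
            ‖gradient (legendre Ω ψ) z - gradient (legendre Ω ψ) z'‖ ≤
              C * (Real.sqrt (lam₁ * lam₂) * (L : ℝ)) /
                (Real.log (1 + 1 / (C * Real.sqrt (lam₁ * lam₂) * ‖z - z'‖))) ^ (1 / 8 : ℝ) := by
  set d := δ / 3 with hdef
  have hd : 0 < d := by positivity
  set C := max (1 / d) (20 * max 1 (D / d)) with hC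
  have hC1 : 1 / d ≤ C := le_max_left _ _
  have hC2 : 20 * max 1 (D / d) ≤ C := le_max_right _ _
  have hC0 : 0 < C := (by positivity : 0 < 1 / d).trans_le hC1
  refine ⟨C, hC0, ?_⟩
  intro Ω μ ν ψ lam₁ lam₂ H hD L hL z hz z' hz' hzz
  simp only [subdiffImage, mem_iUnion] at hz hz'
  obtain ⟨x₀, hx₀, hz⟩ := hz
  obtain ⟨x', hx', hz'⟩ := hz'
  rw [(H.hasGradientAt_legendre hδ hx₀ hz).gradient, (H.hasGradientAt_legendre hδ hx' hz').gradient]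
  have hS : 0 < √(lam₁ * lam₂) := Real.sqrt_pos.2 (mul_pos H.lam₁_pos H.lam₂_pos)
  have hε : 0 < ‖z - z'‖ := norm_pos_iff.2 (sub_ne_zero.2 hzz)
  set X := 1 / (C * √(lam₁ * lam₂) * ‖z - z'‖) with hX
  have hX0 : 0 < X := by positivity
  have hlog : 0 < Real.log (1 + X) := Real.log_pos (by linarith)
  rcases eq_or_ne x₀ x' with rfl | hne
  · rw [sub_self, norm_zero]; positivity
  have hball : Metric.ball x₀ (3 * d) ⊆ Ω := by
    rw [hdef, mul_div_cancel₀ _ (three_ne_zero)]; exact ball_subset_of_mem_innerSet H.isOpen hx₀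
  have hsub : x' ∈ subdiff (legendre Ω ψ) z' := by
    intro w
    have h1 := legendre_eq_of_mem_subdiff H.convex H.isBounded hx'.1 hz'
    have h2 := le_legendre H.convex H.isBounded hx'.1 w
    rw [inner_sub_right]
    linarith
  set u := ‖x₀ - x'‖ with hu
  have hu0 : 0 < u := norm_pos_iff.2 (sub_ne_zero.2 hne)
  have huD : u ≤ D := by
    rw [← hD, hu, ← dist_eq_norm]; exact Metric.dist_le_diam_of_mem H.isBounded hx₀.1 hx'.1
  have key := H.log_rpow_le hd hball hL hz hsub hzz (s := min u d) (lt_min hu0 hd)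
    (min_le_right _ _) (by rw [norm_sub_rev]; exact min_le_left _ _)
  have hmin : u ≤ max 1 (D / d) * min u d := by
    rcases le_total u d with h | h
    · rw [min_eq_left h]
      exact le_mul_of_one_le_left hu0.le (le_max_left _ _)
    · rw [min_eq_right h]
      calc u ≤ D / d * d := by rwa [div_mul_cancel₀ _ hd.ne']
        _ ≤ _ := by gcongr; exact le_max_right _ _
  have hXd : X ≤ d / (√(lam₁ * lam₂) * ‖z - z'‖) := by
    rw [hX, div_le_div_iff₀ (by positivity) (by positivity)]
    have : 1 ≤ C * d := by rwa [div_le_iff₀ hd] at hC1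
    have := mul_le_mul_of_nonneg_right this (mul_pos hS hε).le
    linarith
  rw [le_div_iff₀ (by positivity)]
  have hmono : Real.log (1 + X) ^ (1 / 8 : ℝ) ≤
      Real.log (1 + d / (√(lam₁ * lam₂) * ‖z - z'‖)) ^ (1 / 8 : ℝ) := by
    refine Real.rpow_le_rpow hlog.le (Real.log_le_log (by positivity) (by linarith)) (by norm_num)
  have hm0 : 0 < max 1 (D / d) := lt_max_of_lt_left one_pos
  calc u * Real.log (1 + X) ^ (1 / 8 : ℝ) ≤ (max 1 (D / d) * min u d) *
        Real.log (1 + d / (√(lam₁ * lam₂) * ‖z - z'‖)) ^ (1 / 8 : ℝ) := by gcongr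
    _ = max 1 (D / d) * (min u d *
        Real.log (1 + d / (√(lam₁ * lam₂) * ‖z - z'‖)) ^ (1 / 8 : ℝ)) := by ring
    _ ≤ max 1 (D / d) * (20 * (√(lam₁ * lam₂) * L)) := by gcongr
    _ = (20 * max 1 (D / d)) * (√(lam₁ * lam₂) * L) := by ring
    _ ≤ C * (√(lam₁ * lam₂) * L) := by gcongr

theorem corollary1p5 :
    (∀ δ Λ D K : ℝ, 0 < δ →
      ∃ ρ ρ₁ ρ₂ : ℝ → ℝ, IsModulus ρ ∧ IsModulus ρ₁ ∧ IsModulus ρ₂ ∧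
        ∀ (Ω : Set Plane) (μ ν : Measure Plane) (ψ : Plane → ℝ) (lam₁ lam₂ h₁ h₂ : ℝ),
          Admissible Ω μ ν ψ lam₁ lam₂ h₁ h₂ →
          lam₁ * lam₂ = Λ →
          Metric.diam Ω = D →
          (∀ x ∈ innerSet Ω δ, ∀ y ∈ innerSet Ω δ, segmentNhd x y δ ⊆ Ω →
            Metric.diam (subdiffImage ψ (segmentNhd x y δ)) ≤ K) →
          ∀ z ∈ subdiffImage ψ (innerSet Ω δ), ∀ z' ∈ subdiffImage ψ (innerSet Ω δ),
            ∀ x ∈ subdiff (legendre Ω ψ) z, ∀ x' ∈ subdiff (legendre Ω ψ) z',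
              ‖x - x'‖ ≤ max (ρ ‖z - z'‖) (max (ρ₁ h₁) (ρ₂ h₂))) ∧
    (∀ δ D : ℝ, 0 < δ →
      ∃ C : ℝ, 0 < C ∧
        ∀ (Ω : Set Plane) (μ ν : Measure Plane) (ψ : Plane → ℝ) (lam₁ lam₂ : ℝ),
          Admissible Ω μ ν ψ lam₁ lam₂ 0 0 →
          Metric.diam Ω = D →
          (∀ z ∈ subdiffImage ψ (innerSet Ω δ), ContDiffAt ℝ 1 (legendre Ω ψ) z) ∧
          ∀ L : NNReal, LipschitzOnWith L ψ Ω →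
            ∀ z ∈ subdiffImage ψ (innerSet Ω δ), ∀ z' ∈ subdiffImage ψ (innerSet Ω δ), z ≠ z' →
              ‖gradient (legendre Ω ψ) z - gradient (legendre Ω ψ) z'‖ ≤
                C * (Real.sqrt (lam₁ * lam₂) * (L : ℝ)) /
                  (Real.log (1 + 1 / (C * Real.sqrt (lam₁ * lam₂) * ‖z - z'‖))) ^ (1 / 8 : ℝ)) := by
  refine ⟨fun δ Λ D K hδ => exists_moduli Λ D K hδ, fun δ D hδ => ?_⟩
  obtain ⟨C, hC, h⟩ := exists_gradient_legendre_bound D hδ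
  refine ⟨C, hC, fun Ω μ ν ψ lam₁ lam₂ H hD => ⟨fun z hz => H.contDiffAt_legendre hδ hz, ?_⟩⟩
  exact h Ω μ ν ψ lam₁ lam₂ H hD
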